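/- Let $M$ be a connected smooth 3-dimensional manifold with an almost paracontact metric structure $(\phi,\zeta,\eta,g)$: $\phi$ is a smooth $(1,1)$-tensor field, $\zeta$ a smooth vector field, $\eta$ a smooth one-form and $g$ a smooth semi-Riemannian metric such that $\phi^2=I-\eta\otimes\zeta$, $\eta(\zeta)=1$, the $+1$- and $-1$-eigendistributions of $\phi$ both have dimension $1$, and $g(\phi X,\phi Y)=-g(X,Y)+\eta(X)\eta(Y)$. Suppose that $M$ is para-cosymplectic, that is, $d\eta=0$, $d\Phi=0$ for the fundamental 2-form $\Phi(X,Y)=g(X,\phi Y)$, and the structure is normal (since $d\eta=0$, this means that the Nijenhuis tensor of $\phi$ vanishes identically). Let $S$ be the Ricci tensor and $r$ the scalar curvature of $g$, and suppose that $r$ is constant. Suppose that $M$ admits an $h$-almost gradient Ricci–Yamabe soliton with $h$ constant: there are $\alpha,\beta\in\mathbb R$ and smooth functions $f,\lambda,h:M\to\mathbb R$, with $h$ constant, such that $$h\,\nabla^2 f+\Big(\lambda-\frac{\beta}{2}r\Big)g+\alpha S=0 .$$ Then $\lambda$ is constant; that is, the soliton is an $h$-gradient Ricci–Yamabe soliton.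 -/

import Mathlib

open scoped Manifold ContDiff

namespace ParaGeometry

noncomputable section

/-! ## Tensor calculus in local coordinates

`G` is a field of bilinear forms on (an open subset of) `ℝⁿ`, the coordinate expression of a
semi-Riemannian metric.  Constant vectors `u v w` stand for constant-coefficient coordinate
vector fields, which commute with each other. -/

/-- The coordinate space `ℝⁿ`. -/
abbrev Coord (n : ℕ) : Type := EuclideanSpace ℝ (Fin n)

section Local

variable {n : ℕ}

/-- The `i`-th coordinate vector `∂ᵢ`. -/
def basisVec (i : Fin n) : Coord n := EuclideanSpace.single i 1

/-- Christoffel symbols of the first kind, as a covector in the last slot `w`: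
`½ (∂ᵤ G(v, w) + ∂ᵥ G(u, w) - ∂_w G(u, v))`. -/
def christoffelFirst (G : Coord n → Coord n →L[ℝ] Coord n →L[ℝ] ℝ) (x u v : Coord n) :
    Coord n →L[ℝ] ℝ :=
  (1 / 2 : ℝ) • (fderiv ℝ G x u v + fderiv ℝ G x v u - ((fderiv ℝ G x).flip u).flip v)

/-- Christoffel symbols of the second kind, `Γ(u, v) = ∇_u v` for constant fields `u`, `v`, where
`∇` is the Levi-Civita connection of `G`.  The inverse of `G x : ℝⁿ → (ℝⁿ)*` raises the index. -/
def christoffel (G : Coord n → Coord n →L[ℝ] Coord n →L[ℝ] ℝ) (x u v : Coord n) : Coord n :=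
  (G x).inverse (christoffelFirst G x u v)

/-- The Riemann curvature `R(u, v)w = ∇_u ∇_v w - ∇_v ∇_u w` (constant fields, `[u, v] = 0`). -/
def curvature (G : Coord n → Coord n →L[ℝ] Coord n →L[ℝ] ℝ) (x u v w : Coord n) : Coord n :=
  (fderiv ℝ (fun y => christoffel G y v w) x u + christoffel G x u (christoffel G x v w))
    - (fderiv ℝ (fun y => christoffel G y u w) x v + christoffel G x v (christoffel G x u w))

/-- The Ricci tensor `S(v, w)`, the trace of `u ↦ R(u, v)w`. -/
def ricci (G : Coord n → Coord n →L[ℝ] Coord n →L[ℝ] ℝ) (x v w : Coord n) : ℝ :=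
  ∑ i, (curvature G x (basisVec i) v w) i

/-- The components `gⁱʲ` of the inverse metric. -/
def inverseMetric (G : Coord n → Coord n →L[ℝ] Coord n →L[ℝ] ℝ) (x : Coord n) (i j : Fin n) : ℝ :=
  ((G x).inverse (EuclideanSpace.proj i)) j

/-- The scalar curvature, the metric trace `∑ gⁱʲ Sᵢⱼ` of the Ricci tensor. -/
def scalarCurvature (G : Coord n → Coord n →L[ℝ] Coord n →L[ℝ] ℝ) (x : Coord n) : ℝ :=
  ∑ i, ∑ j, inverseMetric G x i j * ricci G x (basisVec i) (basisVec j)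

/-- The Hessian `(∇²F)(u, v) = u(v F) - (∇_u v) F`. -/
def hessian (G : Coord n → Coord n →L[ℝ] Coord n →L[ℝ] ℝ) (F : Coord n → ℝ)
    (x u v : Coord n) : ℝ :=
  fderiv ℝ (fun y => fderiv ℝ F y v) x u - fderiv ℝ F x (christoffel G x u v)

/-- The exterior derivative of a one-form: `dη(u, v) = u(η(v)) - v(η(u))` (constant fields). -/
def dOneForm (η : Coord n → Coord n →L[ℝ] ℝ) (x u v : Coord n) : ℝ :=
  fderiv ℝ (fun y => η y v) x u - fderiv ℝ (fun y => η y u) x v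

/-- The exterior derivative of a two-form:
`dΦ(u, v, w) = u(Φ(v, w)) + v(Φ(w, u)) + w(Φ(u, v))` (constant fields). -/
def dTwoForm (Φ : Coord n → Coord n → Coord n → ℝ) (x u v w : Coord n) : ℝ :=
  fderiv ℝ (fun y => Φ y v w) x u + fderiv ℝ (fun y => Φ y w u) x v
    + fderiv ℝ (fun y => Φ y u v) x w

/-- The Nijenhuis torsion `[P, P](X, Y) = P²[X, Y] + [PX, PY] - P[PX, Y] - P[X, PY]` of a field of
endomorphisms.  It is tensorial, so its value on `u`, `v` is computed on constant fields. -/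
def nijenhuis (P : Coord n → Coord n →L[ℝ] Coord n) (x u v : Coord n) : Coord n :=
  P x (P x (VectorField.lieBracket ℝ (fun _ => u) (fun _ => v) x))
    + VectorField.lieBracket ℝ (fun y => P y u) (fun y => P y v) x
    - P x (VectorField.lieBracket ℝ (fun y => P y u) (fun _ => v) x)
    - P x (VectorField.lieBracket ℝ (fun _ => u) (fun y => P y v) x)

end Local

/-! ## Tensor fields on a manifold and their coordinate expressions -/

section Manifold

variable {n : ℕ} {M : Type*} [TopologicalSpace M] [ChartedSpace (Coord n) M]

/-- The differential at `y` of the parametrization `e⁻¹` of `M` by a chart `e`. -/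
def paramDeriv (e : OpenPartialHomeomorph M (Coord n)) (y : Coord n) :
    Coord n →L[ℝ] TangentSpace (𝓡 n) (e.symm y) :=
  mfderiv (𝓡 n) (𝓡 n) e.symm y

/-- The differential of the chart `e` at the point with coordinates `y`. -/
def chartDeriv (e : OpenPartialHomeomorph M (Coord n)) (y : Coord n) :
    TangentSpace (𝓡 n) (e.symm y) →L[ℝ] Coord n :=
  mfderiv (𝓡 n) (𝓡 n) e (e.symm y)

/-- Coordinate expression of a `(0,2)`-tensor field. -/
def coordBilin
    (g : ∀ x : M, TangentSpace (𝓡 n) x →L[ℝ] TangentSpace (𝓡 n) x →L[ℝ] ℝ)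
    (e : OpenPartialHomeomorph M (Coord n)) (y : Coord n) : Coord n →L[ℝ] Coord n →L[ℝ] ℝ :=
  ((paramDeriv e y).precomp ℝ).comp ((g (e.symm y)).comp (paramDeriv e y))

/-- Coordinate expression of a `(1,1)`-tensor field. -/
def coordEndo (φ : ∀ x : M, TangentSpace (𝓡 n) x →L[ℝ] TangentSpace (𝓡 n) x)
    (e : OpenPartialHomeomorph M (Coord n)) (y : Coord n) : Coord n →L[ℝ] Coord n :=
  (chartDeriv e y).comp ((φ (e.symm y)).comp (paramDeriv e y))

/-- Coordinate expression of a vector field. -/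
def coordVec (ζ : ∀ x : M, TangentSpace (𝓡 n) x)
    (e : OpenPartialHomeomorph M (Coord n)) (y : Coord n) : Coord n :=
  chartDeriv e y (ζ (e.symm y))

/-- Coordinate expression of a one-form. -/
def coordForm (η : ∀ x : M, TangentSpace (𝓡 n) x →L[ℝ] ℝ)
    (e : OpenPartialHomeomorph M (Coord n)) (y : Coord n) : Coord n →L[ℝ] ℝ :=
  (η (e.symm y)).comp (paramDeriv e y)

end Manifold

/-- A smooth semi-Riemannian metric on an `n`-dimensional manifold: a symmetric nondegenerate
`(0,2)`-tensor field with smooth coordinate expressions. -/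
structure SemiRiemannianMetric (n : ℕ) (M : Type*) [TopologicalSpace M]
    [ChartedSpace (Coord n) M] where
  val : ∀ x : M, TangentSpace (𝓡 n) x →L[ℝ] TangentSpace (𝓡 n) x →L[ℝ] ℝ
  symm : ∀ (x : M) (u v : TangentSpace (𝓡 n) x), val x u v = val x v u
  nondegenerate : ∀ (x : M) (u : TangentSpace (𝓡 n) x),
    (∀ v : TangentSpace (𝓡 n) x, val x u v = 0) → u = 0
  smooth : ∀ e ∈ atlas (Coord n) M, ContDiffOn ℝ ∞ (coordBilin val e) e.target

/-- An almost paracontact metric structure `(φ, ζ, η, g)` on a manifold of dimension `m`. -/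
structure AlmostParacontactMetricStructure (m : ℕ) (M : Type*) [TopologicalSpace M]
    [ChartedSpace (Coord m) M] where
  /-- the `(1,1)`-tensor field `φ` -/
  phi : ∀ x : M, TangentSpace (𝓡 m) x →L[ℝ] TangentSpace (𝓡 m) x
  /-- the characteristic vector field `ζ` -/
  zeta : ∀ x : M, TangentSpace (𝓡 m) x
  /-- the one-form `η` -/
  eta : ∀ x : M, TangentSpace (𝓡 m) x →L[ℝ] ℝ
  /-- the semi-Riemannian metric -/
  g : SemiRiemannianMetric m M
  smooth_phi : ∀ e ∈ atlas (Coord m) M, ContDiffOn ℝ ∞ (coordEndo phi e) e.target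
  smooth_zeta : ∀ e ∈ atlas (Coord m) M, ContDiffOn ℝ ∞ (coordVec zeta e) e.target
  smooth_eta : ∀ e ∈ atlas (Coord m) M, ContDiffOn ℝ ∞ (coordForm eta e) e.target
  phi_sq : ∀ (x : M) (u : TangentSpace (𝓡 m) x), phi x (phi x u) = u - eta x u • zeta x
  eta_zeta : ∀ x : M, eta x (zeta x) = 1
  /-- the dimension is `m = 2k + 1` and the `+1`-eigendistribution of `φ` has dimension `k` -/
  finrank_eigenspace_one : ∀ x : M,
    2 * Module.finrank ℝ (Module.End.eigenspace
      (phi x : TangentSpace (𝓡 m) x →ₗ[ℝ] TangentSpace (𝓡 m) x) (1 : ℝ)) + 1 = m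
  /-- the `-1`-eigendistribution of `φ` has the same dimension `k` -/
  finrank_eigenspace_neg_one : ∀ x : M,
    2 * Module.finrank ℝ (Module.End.eigenspace
      (phi x : TangentSpace (𝓡 m) x →ₗ[ℝ] TangentSpace (𝓡 m) x) (-1 : ℝ)) + 1 = m
  compatible : ∀ (x : M) (u v : TangentSpace (𝓡 m) x),
    g.val x (phi x u) (phi x v) = -g.val x u v + eta x u * eta x v

section Predicates

variable {m : ℕ} {M : Type*} [TopologicalSpace M] [ChartedSpace (Coord m) M]

/-- The coordinate expression of the fundamental two-form `Φ(u, v) = g(u, φ v)`. -/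
def AlmostParacontactMetricStructure.coordFundamental (s : AlmostParacontactMetricStructure m M)
    (e : OpenPartialHomeomorph M (Coord m)) (y u v : Coord m) : ℝ :=
  coordBilin s.g.val e y u (coordEndo s.phi e y v)

/-- Normality: `[φ, φ] - dη ⊗ ζ = 0` for `dη(X, Y) = X(η(Y)) - Y(η(X)) - η([X, Y])`
(with the other usual normalization of `dη` the second term reads `2dη ⊗ ζ`).  If `dη = 0`, this
says that the Nijenhuis torsion of `φ` vanishes. -/
def AlmostParacontactMetricStructure.IsNormal (s : AlmostParacontactMetricStructure m M) : Prop :=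
  ∀ e ∈ atlas (Coord m) M, ∀ y ∈ e.target, ∀ u v : Coord m,
    nijenhuis (coordEndo s.phi e) y u v
      - dOneForm (coordForm s.eta e) y u v • coordVec s.zeta e y = 0

/-- Almost paracosymplectic: `dη = 0` and `dΦ = 0`. -/
def AlmostParacontactMetricStructure.IsAlmostParacosymplectic
    (s : AlmostParacontactMetricStructure m M) : Prop :=
  ∀ e ∈ atlas (Coord m) M, ∀ y ∈ e.target,
    (∀ u v : Coord m, dOneForm (coordForm s.eta e) y u v = 0) ∧
    (∀ u v w : Coord m, dTwoForm (s.coordFundamental e) y u v w = 0)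

/-- Para-cosymplectic: almost paracosymplectic and normal. -/
def AlmostParacontactMetricStructure.IsParaCosymplectic
    (s : AlmostParacontactMetricStructure m M) : Prop :=
  s.IsAlmostParacosymplectic ∧ s.IsNormal

/-- The scalar curvature of `g` is constant (it has the same value in all charts, at all points). -/
def SemiRiemannianMetric.HasConstantScalarCurvature (g : SemiRiemannianMetric m M) : Prop :=
  ∃ c : ℝ, ∀ e ∈ atlas (Coord m) M, ∀ y ∈ e.target, scalarCurvature (coordBilin g.val e) y = c

/-- An `h`-almost gradient Ricci-Yamabe soliton: smooth functions `h`, `f`, `lam` and real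
constants `α`, `β` with `h ∇²f + (lam - (β/2) r) g + α S = 0`, where `S` is the Ricci tensor and
`r` the scalar curvature of `g`. -/
structure IsHAlmostGradientRicciYamabeSoliton (g : SemiRiemannianMetric m M)
    (h f lam : M → ℝ) (α β : ℝ) : Prop where
  smooth_h : ContMDiff (𝓡 m) 𝓘(ℝ, ℝ) ∞ h
  smooth_f : ContMDiff (𝓡 m) 𝓘(ℝ, ℝ) ∞ f
  smooth_lam : ContMDiff (𝓡 m) 𝓘(ℝ, ℝ) ∞ lam
  equation : ∀ e ∈ atlas (Coord m) M, ∀ y ∈ e.target, ∀ u v : Coord m,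
    h (e.symm y) * hessian (coordBilin g.val e) (f ∘ e.symm) y u v
      + (lam (e.symm y) - β / 2 * scalarCurvature (coordBilin g.val e) y)
          * coordBilin g.val e y u v
      + α * ricci (coordBilin g.val e) y u v = 0

/-- An `h`-gradient Ricci-Yamabe soliton: an `h`-almost gradient Ricci-Yamabe soliton for which
`lam` is constant. -/
def IsHGradientRicciYamabeSoliton (g : SemiRiemannianMetric m M)
    (h f lam : M → ℝ) (α β : ℝ) : Prop :=
  IsHAlmostGradientRicciYamabeSoliton g h f lam α β ∧ ∃ c : ℝ, ∀ x : M, lam x = c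

end Predicates

end

end ParaGeometry

/-! Everything is local, so the work is done in charts. Cartan's formula with $d\Phi=0$ and
$\iota_\zeta\Phi=0$ gives $L_\zeta\Phi=0$; combined with normality and $d\eta=0$ it makes $\zeta$ a
Killing field (`lieDeriv_metric`). Then $\nabla\zeta$ is skew, and symmetric because $\eta$ is
closed, so $\zeta$ is parallel (`fderiv_zeta`). Hence every curvature component involving $\zeta$
vanishes, and in dimension three a single component is left: $S=\frac r2(g-\eta\otimes\eta)$
(`ricci_eq`).

If $h=0$, evaluating the soliton equation at $(\zeta,\zeta)$ gives $\lambda=\beta r/2$. Otherwise it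
reads $\nabla^2 f=a\,g+b\,\eta\otimes\eta$ with $b$ constant and $a$ affine in $\lambda$. As $\zeta$
is parallel, $d(\zeta f)=(a+b)\eta$, so $da\wedge\eta=0$ and $da=da(\zeta)\,\eta$. The Ricci
identity on $\zeta$ and the two null eigenvectors $p,q$ of $\phi$ gives $da(\zeta)\,g(p,q)=0$,
whence $da=0$ (`fderiv_eq_zero_of_hessian_eq`). Connectedness of $M$ finishes the proof. -/

namespace ParaGeometry

set_option maxSynthPendingDepth 10

/-! ### Product rules and symmetry of second derivatives -/

section Calculus

variable {V W X : Type*} [NormedAddCommGroup V] [NormedSpace ℝ V] [NormedAddCommGroup W]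
  [NormedSpace ℝ W] [NormedAddCommGroup X] [NormedSpace ℝ X]

lemma fderiv_apply_field {L : V → W →L[ℝ] X} {w : V → W} {x : V} (hL : DifferentiableAt ℝ L x)
    (hw : DifferentiableAt ℝ w x) (a : V) :
    fderiv ℝ (fun y => L y (w y)) x a = fderiv ℝ L x a (w x) + L x (fderiv ℝ w x a) := by
  rw [fderiv_clm_apply hL hw]
  simp [add_comm]

lemma fderiv_apply_const {L : V → W →L[ℝ] X} {x : V} (hL : DifferentiableAt ℝ L x) (a : V)
    (w : W) : fderiv ℝ (fun y => L y w) x a = fderiv ℝ L x a w := by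
  rw [fderiv_apply_field hL (differentiableAt_const w)]
  simp

lemma fderiv_bilin_field {B : V → W →L[ℝ] W →L[ℝ] X} {v w : V → W} {x : V}
    (hB : DifferentiableAt ℝ B x) (hv : DifferentiableAt ℝ v x) (hw : DifferentiableAt ℝ w x)
    (a : V) :
    fderiv ℝ (fun y => B y (v y) (w y)) x a
      = fderiv ℝ B x a (v x) (w x) + B x (fderiv ℝ v x a) (w x)
        + B x (v x) (fderiv ℝ w x a) := by
  rw [fderiv_apply_field (hB.clm_apply hv) hw, fderiv_apply_field hB hv]
  simp

lemma fderiv_bilin_const {B : V → W →L[ℝ] W →L[ℝ] X} {x : V}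
    (hB : DifferentiableAt ℝ B x) (a : V) (v w : W) :
    fderiv ℝ (fun y => B y v w) x a = fderiv ℝ B x a v w := by
  rw [fderiv_bilin_field hB (differentiableAt_const v) (differentiableAt_const w)]
  simp

lemma fderiv_congr_of_isOpen {U : Set V} (hU : IsOpen U) {A B : V → W}
    (h : ∀ y ∈ U, A y = B y) {x : V} (hx : x ∈ U) : fderiv ℝ A x = fderiv ℝ B x :=
  Filter.EventuallyEq.fderiv_eq (Filter.eventuallyEq_of_mem (hU.mem_nhds hx) h)

lemma ContDiffOn.differentiableAt_of_isOpen {U : Set V} (hU : IsOpen U) {A : V → W}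
    (hA : ContDiffOn ℝ ∞ A U) {x : V} (hx : x ∈ U) : DifferentiableAt ℝ A x :=
  (hA.contDiffAt (hU.mem_nhds hx)).differentiableAt (by simp)

lemma ContDiffOn.fderiv_of_isOpen_infty {U : Set V} (hU : IsOpen U) {A : V → W}
    (hA : ContDiffOn ℝ ∞ A U) : ContDiffOn ℝ ∞ (fderiv ℝ A) U :=
  hA.fderiv_of_isOpen hU (by simp)

lemma ContDiffOn.fderiv_fderiv_symm {U : Set V} (hU : IsOpen U) {A : V → W}
    (hA : ContDiffOn ℝ ∞ A U) {x : V} (hx : x ∈ U) (u v : V) :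
    fderiv ℝ (fderiv ℝ A) x u v = fderiv ℝ (fderiv ℝ A) x v u :=
  ((hA.contDiffAt (hU.mem_nhds hx)).isSymmSndFDerivAt
    (by
      rw [minSmoothness_of_isRCLikeNormedField]
      exact WithTop.coe_le_coe.2 (le_top : (2 : ℕ∞) ≤ ⊤))).eq u v

end Calculus

/-! ### Levi-Civita connection, curvature and Hessian of a coordinate metric -/

section Metric

variable {n : ℕ}

/-- `G` is the coordinate expression of a semi-Riemannian metric on the open set `U`. -/
structure IsCoordMetric (G : Coord n → Coord n →L[ℝ] Coord n →L[ℝ] ℝ) (U : Set (Coord n)) :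
    Prop where
  isOpen : IsOpen U
  contDiffOn : ContDiffOn ℝ ∞ G U
  symm : ∀ x ∈ U, ∀ u v, G x u v = G x v u
  nondegenerate : ∀ x ∈ U, ∀ u, (∀ v, G x u v = 0) → u = 0

/-- The Christoffel symbols of the first kind as a trilinear form. -/
noncomputable def christoffelFirstCLM (G : Coord n → Coord n →L[ℝ] Coord n →L[ℝ] ℝ) (x : Coord n) :
    Coord n →L[ℝ] Coord n →L[ℝ] Coord n →L[ℝ] ℝ :=
  (1 / 2 : ℝ) • (fderiv ℝ G x + (fderiv ℝ G x).flip
    - (ContinuousLinearMap.flipₗᵢ ℝ (Coord n) (Coord n)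
        ℝ).toContinuousLinearEquiv.toContinuousLinearMap.comp (fderiv ℝ G x).flip)

/-- The Christoffel symbols of the second kind as a bilinear map. -/
noncomputable def christoffelCLM (G : Coord n → Coord n →L[ℝ] Coord n →L[ℝ] ℝ) (x : Coord n) :
    Coord n →L[ℝ] Coord n →L[ℝ] Coord n :=
  (ContinuousLinearMap.compL ℝ (Coord n) (Coord n →L[ℝ] ℝ) (Coord n) (G x).inverse).comp
    (christoffelFirstCLM G x)

lemma christoffel_eq (G : Coord n → Coord n →L[ℝ] Coord n →L[ℝ] ℝ) (x u v : Coord n) :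
    christoffel G x u v = christoffelCLM G x u v := by
  simp only [christoffel, christoffelCLM, ContinuousLinearMap.comp_apply,
    ContinuousLinearMap.compL_apply]
  rfl

namespace IsCoordMetric

variable {G : Coord n → Coord n →L[ℝ] Coord n →L[ℝ] ℝ} {U : Set (Coord n)} {x : Coord n}

lemma differentiableAt (hG : IsCoordMetric G U) (hx : x ∈ U) : DifferentiableAt ℝ G x :=
  ContDiffOn.differentiableAt_of_isOpen hG.isOpen hG.contDiffOn hx

lemma fderiv_symm (hG : IsCoordMetric G U) (hx : x ∈ U) (a u v : Coord n) :
    fderiv ℝ G x a u v = fderiv ℝ G x a v u := by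
  rw [← fderiv_bilin_const (hG.differentiableAt hx), ← fderiv_bilin_const (hG.differentiableAt hx),
    fderiv_congr_of_isOpen hG.isOpen (fun y hy => hG.symm y hy u v) hx]

/-- `inverse` is zero on a non-invertible map, so the Christoffel symbols mean something only
because nondegeneracy makes `G x` an injection into a dual space of equal dimension. -/
lemma isInvertible (hG : IsCoordMetric G U) (hx : x ∈ U) : (G x).IsInvertible := by
  have hinj : Function.Injective (G x).toLinearMap := by
    rw [← LinearMap.ker_eq_bot, LinearMap.ker_eq_bot']
    intro u hu
    exact hG.nondegenerate x hx u fun v => by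
      have := DFunLike.congr_fun hu v
      simpa using this
  have hd : Module.finrank ℝ (Coord n) = Module.finrank ℝ (Coord n →L[ℝ] ℝ) := by
    rw [← LinearEquiv.finrank_eq (LinearMap.toContinuousLinearMap (𝕜 := ℝ) (E := Coord n)
      (F' := ℝ))]
    exact (Subspace.dual_finrank_eq (K := ℝ) (V := Coord n)).symm
  refine ⟨(LinearEquiv.ofInjectiveOfFinrankEq _ hinj hd).toContinuousLinearEquiv, ?_⟩
  ext u v
  rfl

lemma apply_inverse (hG : IsCoordMetric G U) (hx : x ∈ U) (l : Coord n →L[ℝ] ℝ) :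
    G x ((G x).inverse l) = l :=
  (((hG.isInvertible hx).inverse_apply_eq).1 rfl).symm

lemma ext_right (hG : IsCoordMetric G U) (hx : x ∈ U) {u v : Coord n}
    (h : ∀ w, G x u w = G x v w) : u = v := by
  rw [← sub_eq_zero]
  exact hG.nondegenerate x hx _ fun w => by simp [h w]

lemma apply_christoffel (hG : IsCoordMetric G U) (hx : x ∈ U) (u v w : Coord n) :
    G x (christoffelCLM G x u v) w
      = 1 / 2 * (fderiv ℝ G x u v w + fderiv ℝ G x v u w - fderiv ℝ G x w u v) := by
  rw [← christoffel_eq, christoffel, hG.apply_inverse hx]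
  simp [christoffelFirst]

lemma christoffel_symm (hG : IsCoordMetric G U) (hx : x ∈ U) (u v : Coord n) :
    christoffelCLM G x u v = christoffelCLM G x v u := by
  refine hG.ext_right hx fun w => ?_
  rw [hG.apply_christoffel hx, hG.apply_christoffel hx, hG.fderiv_symm hx w u v]
  ring

/-- Metric compatibility, $\nabla G=0$. -/
lemma fderiv_eq (hG : IsCoordMetric G U) (hx : x ∈ U) (u v w : Coord n) :
    fderiv ℝ G x u v w
      = G x (christoffelCLM G x u v) w + G x v (christoffelCLM G x u w) := by
  rw [hG.symm x hx v, hG.apply_christoffel hx, hG.apply_christoffel hx, hG.fderiv_symm hx u w v,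
    hG.fderiv_symm hx w u v, hG.fderiv_symm hx v u w]
  ring

lemma contDiffOn_christoffelFirst (hG : IsCoordMetric G U) :
    ContDiffOn ℝ ∞ (christoffelFirstCLM G) U := by
  have h1 := ContDiffOn.fderiv_of_isOpen_infty hG.isOpen hG.contDiffOn
  have h2 : ContDiffOn ℝ ∞ (fun x => (fderiv ℝ G x).flip) U :=
    (ContinuousLinearMap.flipₗᵢ ℝ (Coord n) (Coord n)
      (Coord n →L[ℝ] ℝ)).toContinuousLinearEquiv.contDiff.comp_contDiffOn h1
  exact (((h1.add h2).sub (contDiffOn_const.clm_comp h2)).const_smul (1 / 2 : ℝ))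

lemma contDiffOn_christoffel (hG : IsCoordMetric G U) :
    ContDiffOn ℝ ∞ (christoffelCLM G) U := by
  have h1 : ContDiffOn ℝ ∞ (fun x => (G x).inverse) U := fun x hx =>
    ((hG.isInvertible hx).contDiffAt_map_inverse.comp x
      (hG.contDiffOn.contDiffAt (hG.isOpen.mem_nhds hx))).contDiffWithinAt
  exact ((ContinuousLinearMap.compL ℝ (Coord n) (Coord n →L[ℝ] ℝ)
    (Coord n)).contDiff.comp_contDiffOn h1).clm_comp hG.contDiffOn_christoffelFirst

lemma differentiableAt_christoffel (hG : IsCoordMetric G U) (hx : x ∈ U) :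
    DifferentiableAt ℝ (christoffelCLM G) x :=
  ContDiffOn.differentiableAt_of_isOpen hG.isOpen hG.contDiffOn_christoffel hx

lemma fderiv_christoffel_symm (hG : IsCoordMetric G U) (hx : x ∈ U) (a u v : Coord n) :
    fderiv ℝ (christoffelCLM G) x a u v = fderiv ℝ (christoffelCLM G) x a v u := by
  rw [← fderiv_bilin_const (hG.differentiableAt_christoffel hx),
    ← fderiv_bilin_const (hG.differentiableAt_christoffel hx),
    fderiv_congr_of_isOpen hG.isOpen (fun y hy => hG.christoffel_symm hy u v) hx]

lemma curvature_eq (hG : IsCoordMetric G U) (hx : x ∈ U) (u v w : Coord n) :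
    curvature G x u v w
      = fderiv ℝ (christoffelCLM G) x u v w + christoffelCLM G x u (christoffelCLM G x v w)
        - (fderiv ℝ (christoffelCLM G) x v u w
          + christoffelCLM G x v (christoffelCLM G x u w)) := by
  simp only [curvature, christoffel_eq, fderiv_bilin_const (hG.differentiableAt_christoffel hx)]

lemma curvature_antisymm (hG : IsCoordMetric G U) (hx : x ∈ U) (u v w : Coord n) :
    curvature G x u v w = -curvature G x v u w := by
  rw [hG.curvature_eq hx, hG.curvature_eq hx]
  abel

/-- Since $\Gamma$ is symmetric, the terms of the cyclic sum cancel in pairs. -/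
lemma curvature_bianchi (hG : IsCoordMetric G U) (hx : x ∈ U) (u v w : Coord n) :
    curvature G x u v w + curvature G x v w u + curvature G x w u v = 0 := by
  rw [hG.curvature_eq hx, hG.curvature_eq hx, hG.curvature_eq hx,
    hG.fderiv_christoffel_symm hx u v w, hG.fderiv_christoffel_symm hx v w u,
    hG.fderiv_christoffel_symm hx w u v, hG.christoffel_symm hx v w,
    hG.christoffel_symm hx w u, hG.christoffel_symm hx u v]
  abel

lemma curvature_skew (hG : IsCoordMetric G U) (hx : x ∈ U) (u v w z : Coord n) :
    G x (curvature G x u v w) z = -G x w (curvature G x u v z) := by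
  have hD := hG.differentiableAt hx
  have hΓ := hG.differentiableAt_christoffel hx
  have key : ∀ a b : Coord n, fderiv ℝ (fderiv ℝ G) x a b w z
      = fderiv ℝ G x a (christoffelCLM G x b w) z
        + G x (fderiv ℝ (christoffelCLM G) x a b w) z
        + (fderiv ℝ G x a w (christoffelCLM G x b z)
        + G x w (fderiv ℝ (christoffelCLM G) x a b z)) := by
    intro a b
    have hD2 : DifferentiableAt ℝ (fderiv ℝ G) x := ContDiffOn.differentiableAt_of_isOpen
      hG.isOpen (ContDiffOn.fderiv_of_isOpen_infty hG.isOpen hG.contDiffOn) hx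
    have hc : ∀ c, DifferentiableAt ℝ (fun y => christoffelCLM G y b c) x := fun c =>
      (hΓ.clm_apply (differentiableAt_const b)).clm_apply (differentiableAt_const c)
    have e1 : fderiv ℝ (fun y => fderiv ℝ G y b w z) x a
        = fderiv ℝ (fderiv ℝ G) x a b w z := by
      rw [fderiv_bilin_const (hD2.clm_apply (differentiableAt_const b)), fderiv_apply_const hD2]
    rw [← e1, fderiv_congr_of_isOpen hG.isOpen (fun y hy => hG.fderiv_eq hy b w z) hx,
      fderiv_fun_add ((hD.clm_apply (hc w)).clm_apply (differentiableAt_const z))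
        ((hD.clm_apply (differentiableAt_const w)).clm_apply (hc z)),
      add_apply, fderiv_bilin_field hD (hc w) (differentiableAt_const z),
      fderiv_bilin_field hD (differentiableAt_const w) (hc z), fderiv_bilin_const hΓ,
      fderiv_bilin_const hΓ]
    simp
  -- The left sides agree by symmetry of second derivatives. After expanding $\partial G$ through
  -- $\Gamma$, the cross terms $G(\Gamma_u w,\Gamma_v z)+G(\Gamma_v w,\Gamma_u z)$ are symmetric in
  -- $u,v$ and cancel in the difference.
  have h1 := key u v
  have h2 := key v u
  rw [ContDiffOn.fderiv_fderiv_symm hG.isOpen hG.contDiffOn hx v u] at h2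
  simp only [hG.fderiv_eq hx] at h1 h2
  rw [hG.curvature_eq hx, hG.curvature_eq hx]
  simp only [map_sub, map_add, sub_apply, add_apply]
  linarith

lemma curvature_apply_sum (hG : IsCoordMetric G U) (hx : x ∈ U) {ι : Type*} (s : Finset ι)
    (c : ι → ℝ) (e : ι → Coord n) (u v : Coord n) :
    curvature G x u v (∑ i ∈ s, c i • e i) = ∑ i ∈ s, c i • curvature G x u v (e i) := by
  simp only [hG.curvature_eq hx, map_sum, map_smul, ← Finset.sum_add_distrib,
    ← Finset.sum_sub_distrib, smul_add, smul_sub]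

lemma curvature_sum_middle (hG : IsCoordMetric G U) (hx : x ∈ U) {ι : Type*} (s : Finset ι)
    (c : ι → ℝ) (e : ι → Coord n) (u w : Coord n) :
    curvature G x u (∑ i ∈ s, c i • e i) w = ∑ i ∈ s, c i • curvature G x u (e i) w := by
  simp only [hG.curvature_eq hx, map_sum, map_smul, sum_apply,
    smul_apply, ← Finset.sum_add_distrib, ← Finset.sum_sub_distrib, smul_add, smul_sub]

/-- The Ricci tensor computed in an arbitrary basis. -/
lemma ricci_eq_sum_repr (hG : IsCoordMetric G U) (hx : x ∈ U) {ι : Type*} [Fintype ι]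
    [DecidableEq ι] (b : Module.Basis ι ℝ (Coord n)) (v w : Coord n) :
    ricci G x v w = ∑ i, b.repr (curvature G x (b i) v w) i := by
  let T : Coord n →ₗ[ℝ] Coord n :=
    { toFun := fun u => curvature G x u v w
      map_add' := fun a c => by
        simp only [hG.curvature_eq hx, map_add, add_apply]
        abel
      map_smul' := fun a c => by
        simp only [hG.curvature_eq hx, map_smul, smul_apply, RingHom.id_apply, smul_add,
          smul_sub] }
  have h1 := LinearMap.trace_eq_matrix_trace ℝ b T
  have h2 := LinearMap.trace_eq_matrix_trace ℝ (EuclideanSpace.basisFun (Fin n) ℝ).toBasis T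
  rw [h1] at h2
  simp only [Matrix.trace, Matrix.diag, LinearMap.toMatrix_apply] at h2
  rw [show (∑ i, b.repr (curvature G x (b i) v w) i) = ∑ i, b.repr (T (b i)) i from rfl, h2, ricci]
  refine Finset.sum_congr rfl fun i _ => ?_
  simp [T, basisVec]

lemma sum_inverseMetric_mul (hG : IsCoordMetric G U) (hx : x ∈ U) :
    ∑ i, ∑ j, inverseMetric G x i j * G x (basisVec i) (basisVec j) = n := by
  have h : ∀ i, ∑ j, inverseMetric G x i j * G x (basisVec i) (basisVec j) = 1 := by
    intro i
    -- Raising the index of $dx^i$ gives the vector with components $g^{ij}$.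
    have e : (G x).inverse (EuclideanSpace.proj i)
        = ∑ j, inverseMetric G x i j • basisVec j := by
      ext k
      simp [inverseMetric, basisVec, Pi.single_apply]
    have := hG.apply_inverse hx (EuclideanSpace.proj i)
    have h2 := congrArg (fun l => l (basisVec i)) this
    rw [hG.symm x hx] at h2
    rw [e] at h2
    simpa [basisVec] using h2
  simp [h]

lemma sum_inverseMetric_mul_form (hG : IsCoordMetric G U) (hx : x ∈ U) (z : Coord n) :
    ∑ i, ∑ j, inverseMetric G x i j * (G x z (basisVec i) * G x z (basisVec j)) = G x z z := by
  have h : ∀ i, ∑ j, inverseMetric G x i j * (G x z (basisVec i) * G x z (basisVec j))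
      = z i * G x z (basisVec i) := by
    intro i
    have e : (G x).inverse (EuclideanSpace.proj i)
        = ∑ j, inverseMetric G x i j • basisVec j := by
      ext k
      simp [inverseMetric, basisVec, Pi.single_apply]
    have := hG.apply_inverse hx (EuclideanSpace.proj i)
    have h2 := congrArg (fun l => l z) this
    rw [hG.symm x hx, e] at h2
    simp only [map_sum, map_smul, smul_eq_mul] at h2
    rw [show z i = (EuclideanSpace.proj i : Coord n →L[ℝ] ℝ) z from rfl, ← h2, Finset.sum_mul]
    exact Finset.sum_congr rfl fun j _ => by ring
  simp only [h]
  have e : z = ∑ i, z i • basisVec i := by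
    ext k
    simp [basisVec, Pi.single_apply]
  conv_rhs => rw [show G x z z = G x z (∑ i, z i • basisVec i) by rw [← e]]
  simp

lemma scalarCurvature_eq (hG : IsCoordMetric G U) (hx : x ∈ U) {ρ : ℝ} {z : Coord n}
    (h : ∀ v w, ricci G x v w = ρ * (G x v w - G x z v * G x z w)) :
    scalarCurvature G x = ρ * (n - G x z z) := by
  rw [scalarCurvature, ← hG.sum_inverseMetric_mul hx, ← hG.sum_inverseMetric_mul_form hx z,
    ← Finset.sum_sub_distrib, Finset.mul_sum]
  refine Finset.sum_congr rfl fun i _ => ?_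
  rw [← Finset.sum_sub_distrib, Finset.mul_sum]
  refine Finset.sum_congr rfl fun j _ => ?_
  rw [h]
  ring

lemma hessian_eq {F : Coord n → ℝ} (hG : IsCoordMetric G U) (hF : ContDiffOn ℝ ∞ F U)
    (hx : x ∈ U) (u v : Coord n) :
    hessian G F x u v = fderiv ℝ (fderiv ℝ F) x u v - fderiv ℝ F x (christoffelCLM G x u v) := by
  have hF2 : DifferentiableAt ℝ (fderiv ℝ F) x := ContDiffOn.differentiableAt_of_isOpen
    hG.isOpen (ContDiffOn.fderiv_of_isOpen_infty hG.isOpen hF) hx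
  rw [hessian, fderiv_apply_const hF2, christoffel_eq]

/-- The Ricci identity `(∇_u ∇²F)(v, w) - (∇_v ∇²F)(u, w) = -dF (R(u, v) w)`. -/
lemma fderiv_hessian_sub {F : Coord n → ℝ} (hG : IsCoordMetric G U) (hF : ContDiffOn ℝ ∞ F U)
    (hx : x ∈ U) (u v w : Coord n) :
    (fderiv ℝ (fun y => hessian G F y v w) x u - hessian G F x v (christoffelCLM G x u w))
      - (fderiv ℝ (fun y => hessian G F y u w) x v - hessian G F x u (christoffelCLM G x v w))
      = -fderiv ℝ F x (curvature G x u v w) := by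
  -- The terms $\nabla^2F(\Gamma(u,v),w)$ of the two covariant derivatives are equal by symmetry of
  -- $\Gamma$, hence absent from the statement.
  have hF1 := ContDiffOn.fderiv_of_isOpen_infty hG.isOpen hF
  have hF2 := ContDiffOn.fderiv_of_isOpen_infty hG.isOpen hF1
  have hd1 := ContDiffOn.differentiableAt_of_isOpen hG.isOpen hF1 hx
  have hd2 := ContDiffOn.differentiableAt_of_isOpen hG.isOpen hF2 hx
  have hΓ := hG.differentiableAt_christoffel hx
  have key : ∀ a b : Coord n, fderiv ℝ (fun y => hessian G F y b w) x a
      = fderiv ℝ (fderiv ℝ (fderiv ℝ F)) x a b w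
        - (fderiv ℝ (fderiv ℝ F) x a (christoffelCLM G x b w)
          + fderiv ℝ F x (fderiv ℝ (christoffelCLM G) x a b w)) := by
    intro a b
    have hc : DifferentiableAt ℝ (fun y => christoffelCLM G y b w) x :=
      (hΓ.clm_apply (differentiableAt_const b)).clm_apply (differentiableAt_const w)
    rw [fderiv_congr_of_isOpen hG.isOpen (fun y hy => hG.hessian_eq hF hy b w) hx,
      fderiv_fun_sub ((hd2.clm_apply (differentiableAt_const b)).clm_apply
        (differentiableAt_const w)) (hd1.clm_apply hc), sub_apply,
      fderiv_bilin_const hd2, fderiv_apply_field hd1 hc, fderiv_bilin_const hΓ]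
  rw [key, key, hG.hessian_eq hF hx, hG.hessian_eq hF hx, hG.curvature_eq hx,
    ContDiffOn.fderiv_fderiv_symm hG.isOpen hF1 hx u v]
  simp only [map_sub, map_add]
  ring

end IsCoordMetric

end Metric

/-! ### Para-cosymplectic structures: the characteristic field is parallel -/

section ParaCosymplectic

variable {n : ℕ}

/-- `(P, Z, E, G)` is the coordinate expression of a para-cosymplectic structure on `U`. -/
structure IsCoordParaCosymplectic (G : Coord n → Coord n →L[ℝ] Coord n →L[ℝ] ℝ)
    (P : Coord n → Coord n →L[ℝ] Coord n) (Z : Coord n → Coord n) (E : Coord n → Coord n →L[ℝ] ℝ)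
    (U : Set (Coord n)) : Prop extends IsCoordMetric G U where
  contDiffOn_phi : ContDiffOn ℝ ∞ P U
  contDiffOn_zeta : ContDiffOn ℝ ∞ Z U
  contDiffOn_eta : ContDiffOn ℝ ∞ E U
  phi_sq : ∀ x ∈ U, ∀ u, P x (P x u) = u - E x u • Z x
  eta_zeta : ∀ x ∈ U, E x (Z x) = 1
  compatible : ∀ x ∈ U, ∀ u v, G x (P x u) (P x v) = -G x u v + E x u * E x v
  dOneForm_eq_zero : ∀ x ∈ U, ∀ u v, dOneForm E x u v = 0
  dTwoForm_eq_zero : ∀ x ∈ U, ∀ u v w, dTwoForm (fun y a b => G y a (P y b)) x u v w = 0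
  nijenhuis_eq_zero : ∀ x ∈ U, ∀ u v, nijenhuis P x u v = 0

namespace IsCoordParaCosymplectic

variable {G : Coord n → Coord n →L[ℝ] Coord n →L[ℝ] ℝ}
  {P : Coord n → Coord n →L[ℝ] Coord n} {Z : Coord n → Coord n} {E : Coord n → Coord n →L[ℝ] ℝ}
  {U : Set (Coord n)} {x : Coord n}

lemma differentiableAt_phi (hs : IsCoordParaCosymplectic G P Z E U) (hx : x ∈ U) :
    DifferentiableAt ℝ P x :=
  ContDiffOn.differentiableAt_of_isOpen hs.isOpen hs.contDiffOn_phi hx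

lemma differentiableAt_zeta (hs : IsCoordParaCosymplectic G P Z E U) (hx : x ∈ U) :
    DifferentiableAt ℝ Z x :=
  ContDiffOn.differentiableAt_of_isOpen hs.isOpen hs.contDiffOn_zeta hx

lemma differentiableAt_eta (hs : IsCoordParaCosymplectic G P Z E U) (hx : x ∈ U) :
    DifferentiableAt ℝ E x :=
  ContDiffOn.differentiableAt_of_isOpen hs.isOpen hs.contDiffOn_eta hx

lemma phi_zeta (hs : IsCoordParaCosymplectic G P Z E U) (hx : x ∈ U) : P x (Z x) = 0 := by
  have h1 : P x (P x (Z x)) = 0 := by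
    rw [hs.phi_sq x hx, hs.eta_zeta x hx, one_smul, sub_self]
  have h2 := hs.phi_sq x hx (P x (Z x))
  rw [h1, map_zero] at h2
  have h3 : P x (Z x) = E x (P x (Z x)) • Z x := (sub_eq_zero.1 h2.symm)
  -- Now $\phi\zeta=c\zeta$ with $c=\eta(\phi\zeta)$; applying $\phi$ and then $\eta$ gives $c^2=0$.
  have h4 : E x (P x (Z x)) * E x (P x (Z x)) = 0 := by
    have := congrArg (fun u => E x (P x u)) h3
    simpa [h1] using this.symm
  rw [h3, mul_self_eq_zero.1 h4, zero_smul]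

/-- Compute $\phi^3u$ as $\phi(\phi^2u)$ and as $\phi^2(\phi u)$. -/
lemma eta_phi (hs : IsCoordParaCosymplectic G P Z E U) (hx : x ∈ U) (u : Coord n) :
    E x (P x u) = 0 := by
  have h1 := congrArg (P x) (hs.phi_sq x hx u)
  rw [map_sub, map_smul, hs.phi_zeta hx, smul_zero, sub_zero, hs.phi_sq x hx] at h1
  have h2 := congrArg (E x) (sub_eq_self.1 h1)
  simpa [hs.eta_zeta x hx] using h2

lemma metric_zeta (hs : IsCoordParaCosymplectic G P Z E U) (hx : x ∈ U) (u : Coord n) :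
    G x u (Z x) = E x u := by
  have h := hs.compatible x hx u (Z x)
  rw [hs.phi_zeta hx, map_zero, hs.eta_zeta x hx] at h
  linarith

lemma zeta_metric (hs : IsCoordParaCosymplectic G P Z E U) (hx : x ∈ U) (u : Coord n) :
    G x (Z x) u = E x u := by
  rw [hs.symm x hx, hs.metric_zeta hx]

lemma metric_phi_skew (hs : IsCoordParaCosymplectic G P Z E U) (hx : x ∈ U) (u v : Coord n) :
    G x u (P x v) = -G x (P x u) v := by
  have h := hs.compatible x hx (P x u) v
  rw [hs.phi_sq x hx, hs.eta_phi hx] at h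
  simp only [map_sub, map_smul, sub_apply, smul_apply, smul_eq_mul, hs.zeta_metric hx,
    hs.eta_phi hx] at h
  linarith

lemma fderiv_eta_symm (hs : IsCoordParaCosymplectic G P Z E U) (hx : x ∈ U) (u v : Coord n) :
    fderiv ℝ E x u v = fderiv ℝ E x v u := by
  have h := hs.dOneForm_eq_zero x hx u v
  rw [dOneForm, fderiv_apply_const (hs.differentiableAt_eta hx),
    fderiv_apply_const (hs.differentiableAt_eta hx)] at h
  linarith

lemma fderiv_eta (hs : IsCoordParaCosymplectic G P Z E U) (hx : x ∈ U) (a u : Coord n) :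
    fderiv ℝ E x a u = fderiv ℝ G x a u (Z x) + G x u (fderiv ℝ Z x a) := by
  rw [← fderiv_apply_const (hs.differentiableAt_eta hx),
    ← fderiv_congr_of_isOpen hs.isOpen (fun y hy => hs.metric_zeta hy u) hx,
    fderiv_bilin_field (hs.differentiableAt hx) (differentiableAt_const u)
      (hs.differentiableAt_zeta hx)]
  simp

lemma fderiv_eta_zeta (hs : IsCoordParaCosymplectic G P Z E U) (hx : x ∈ U) (a : Coord n) :
    fderiv ℝ E x a (Z x) + E x (fderiv ℝ Z x a) = 0 := by
  rw [← fderiv_apply_field (hs.differentiableAt_eta hx) (hs.differentiableAt_zeta hx),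
    fderiv_congr_of_isOpen hs.isOpen (fun y hy => hs.eta_zeta y hy) hx]
  simp

lemma fderiv_phi_zeta (hs : IsCoordParaCosymplectic G P Z E U) (hx : x ∈ U) (a : Coord n) :
    fderiv ℝ P x a (Z x) = -P x (fderiv ℝ Z x a) := by
  rw [← add_eq_zero_iff_eq_neg,
    ← fderiv_apply_field (hs.differentiableAt_phi hx) (hs.differentiableAt_zeta hx),
    fderiv_congr_of_isOpen hs.isOpen (fun y hy => hs.phi_zeta hy) hx]
  simp

lemma fderiv_phi_sq (hs : IsCoordParaCosymplectic G P Z E U) (hx : x ∈ U) (a v : Coord n) :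
    fderiv ℝ P x a (P x v) + P x (fderiv ℝ P x a v)
      = -(fderiv ℝ E x a v • Z x) - E x v • fderiv ℝ Z x a := by
  have hP := hs.differentiableAt_phi hx
  have hE := (hs.differentiableAt_eta hx).clm_apply (differentiableAt_const v)
  rw [← fderiv_apply_const hP a v,
    ← fderiv_apply_field hP (hP.clm_apply (differentiableAt_const v)),
    fderiv_congr_of_isOpen hs.isOpen (fun y hy => hs.phi_sq y hy v) hx,
    fderiv_fun_sub (differentiableAt_const v) (hE.fun_smul (hs.differentiableAt_zeta hx)),
    fderiv_fun_smul hE (hs.differentiableAt_zeta hx)]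
  simp only [fderiv_fun_const, Pi.zero_apply, sub_apply, zero_apply, add_apply, smul_apply,
    ContinuousLinearMap.smulRight_apply, fderiv_apply_const (hs.differentiableAt_eta hx)]
  abel

/-- The Lie derivative of `φ` along `ζ` takes values in the kernel of `φ`. -/
lemma phi_lieDeriv_phi (hs : IsCoordParaCosymplectic G P Z E U) (hx : x ∈ U) (v : Coord n) :
    P x (fderiv ℝ P x (Z x) v) = P x (fderiv ℝ Z x (P x v)) - P x (P x (fderiv ℝ Z x v)) := by
  have hP := hs.differentiableAt_phi hx
  -- Here $\zeta$ is frozen at $x$: the field $y\mapsto\phi_y(\zeta_x)$ vanishes at $x$, but its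
  -- derivative there is $-\phi(d\zeta)$, which supplies the missing terms of $L_\zeta\phi$.
  have h := hs.nijenhuis_eq_zero x hx (Z x) v
  simp only [nijenhuis, VectorField.lieBracket_eq, fderiv_apply_const hP, fderiv_fun_const,
    Pi.zero_apply, zero_apply, sub_self, map_zero, hs.phi_zeta hx, zero_add, zero_sub, sub_zero,
    hs.fderiv_phi_zeta hx, neg_neg] at h
  rw [← sub_eq_zero, ← neg_eq_zero, ← h]
  abel

/-- $L_\zeta\Phi=\iota_\zeta d\Phi+d\,\iota_\zeta\Phi=0$; the second term enters through the
derivative of $g(\zeta,\phi u)=0$. -/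
lemma lieDeriv_fundamental (hs : IsCoordParaCosymplectic G P Z E U) (hx : x ∈ U) (u v : Coord n) :
    fderiv ℝ G x (Z x) u (P x v) + G x u (fderiv ℝ P x (Z x) v)
      + G x (fderiv ℝ Z x u) (P x v) + G x u (P x (fderiv ℝ Z x v)) = 0 := by
  have hP := hs.differentiableAt_phi hx
  have hG := hs.differentiableAt hx
  have hΦ : ∀ a b c, fderiv ℝ (fun y => G y b (P y c)) x a
      = fderiv ℝ G x a b (P x c) + G x b (fderiv ℝ P x a c) := by
    intro a b c
    rw [fderiv_bilin_field hG (differentiableAt_const b) (hP.clm_apply (differentiableAt_const c)),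
      fderiv_apply_const hP]
    simp
  have h1 := hs.dTwoForm_eq_zero x hx (Z x) u v
  simp only [dTwoForm, hΦ, hs.phi_zeta hx, map_zero, hs.fderiv_phi_zeta hx, map_neg] at h1
  have h2 : fderiv ℝ G x v (Z x) (P x u) + G x (fderiv ℝ Z x v) (P x u)
      + G x (Z x) (fderiv ℝ P x v u) = 0 := by
    rw [← fderiv_apply_const hP v u, ← fderiv_bilin_field hG (hs.differentiableAt_zeta hx)
      (hP.clm_apply (differentiableAt_const u)), fderiv_congr_of_isOpen hs.isOpen
        (B := fun _ => (0 : ℝ)) (fun y hy => by rw [hs.zeta_metric hy, hs.eta_phi hy]) hx]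
    simp
  have h3 := hs.metric_phi_skew hx u (fderiv ℝ Z x v)
  have h4 := hs.metric_phi_skew hx v (fderiv ℝ Z x u)
  have h5 := hs.symm x hx (P x v) (fderiv ℝ Z x u)
  have h6 := hs.symm x hx (P x u) (fderiv ℝ Z x v)
  linarith

/-- The characteristic vector field is a Killing field. -/
lemma lieDeriv_metric (hs : IsCoordParaCosymplectic G P Z E U) (hx : x ∈ U) (u v : Coord n) :
    fderiv ℝ G x (Z x) u v + G x (fderiv ℝ Z x u) v + G x u (fderiv ℝ Z x v) = 0 := by
  -- With $\phi v$ in the second slot, $\Phi(u,\phi v)=g(u,\phi^2v)$ recovers $g$ up to terms in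
  -- $\eta$.
  have h1 := hs.lieDeriv_fundamental hx u (P x v)
  have h2 := congrArg (G x u) (hs.fderiv_phi_sq hx (Z x) v)
  rw [hs.phi_lieDeriv_phi hx] at h2
  have h3 := hs.fderiv_eta hx (Z x) u
  have h4 := hs.fderiv_eta_zeta hx u
  have h5 := hs.fderiv_eta_zeta hx v
  have h6 := hs.fderiv_eta_symm hx u (Z x)
  have h7 := hs.fderiv_eta_symm hx v (Z x)
  simp only [hs.phi_sq x hx, map_sub, map_add, map_neg, map_smul, smul_eq_mul,
    hs.metric_zeta hx] at h1 h2
  -- Closedness of $\eta$ turns the derivative of $\eta(\zeta)=1$ into $L_\zeta\eta=0$, which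
  -- disposes of the $\eta$ terms.
  rw [h6] at h4
  rw [h7] at h5
  have h8 : fderiv ℝ G x (Z x) u (Z x) = -E x (fderiv ℝ Z x u) - G x u (fderiv ℝ Z x (Z x)) := by
    linarith
  rw [h8] at h1
  rw [show fderiv ℝ E x (Z x) v = -E x (fderiv ℝ Z x v) by linarith] at h2
  linarith

/-- The characteristic vector field is parallel. -/
lemma fderiv_zeta (hs : IsCoordParaCosymplectic G P Z E U) (hx : x ∈ U) (u : Coord n) :
    fderiv ℝ Z x u = -christoffelCLM G x u (Z x) := by
  rw [← add_eq_zero_iff_eq_neg]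
  refine hs.nondegenerate x hx _ fun v => ?_
  -- The form $g(\nabla_u\zeta,v)$ is symmetric because $d\eta=0$ and skew because $\zeta$ is
  -- Killing.
  have h1 := hs.fderiv_eta hx u v
  have h2 := hs.fderiv_eta hx v u
  have h3 := hs.lieDeriv_metric hx u v
  rw [hs.fderiv_eta_symm hx u v] at h1
  rw [map_add, add_apply, hs.apply_christoffel hx, hs.fderiv_symm hx u (Z x) v]
  have h4 := hs.symm x hx (fderiv ℝ Z x u) v
  linarith

/-- The characteristic one-form is parallel. -/
lemma fderiv_eta_eq (hs : IsCoordParaCosymplectic G P Z E U) (hx : x ∈ U) (u v : Coord n) :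
    fderiv ℝ E x u v = E x (christoffelCLM G x u v) := by
  rw [hs.fderiv_eta hx, hs.fderiv_eq hx, hs.fderiv_zeta hx, hs.metric_zeta hx, map_neg,
    add_neg_cancel_right]

/-- The integrability condition of $d\zeta=-\Gamma\zeta$: second derivatives of $\zeta$ commute. -/
lemma curvature_zeta (hs : IsCoordParaCosymplectic G P Z E U) (hx : x ∈ U) (u v : Coord n) :
    curvature G x u v (Z x) = 0 := by
  have hΓ := hs.differentiableAt_christoffel hx
  have hZ := hs.differentiableAt_zeta hx
  have key : ∀ a b, fderiv ℝ (fderiv ℝ Z) x a b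
      = -(fderiv ℝ (christoffelCLM G) x a b (Z x)
        - christoffelCLM G x b (christoffelCLM G x a (Z x))) := by
    intro a b
    have hZ2 : DifferentiableAt ℝ (fderiv ℝ Z) x := ContDiffOn.differentiableAt_of_isOpen
      hs.isOpen (ContDiffOn.fderiv_of_isOpen_infty hs.isOpen hs.contDiffOn_zeta) hx
    rw [← fderiv_apply_const hZ2, fderiv_congr_of_isOpen hs.isOpen
      (fun y hy => hs.fderiv_zeta hy b) hx, fderiv_fun_neg, neg_apply,
      fderiv_bilin_field hΓ (differentiableAt_const b) hZ, hs.fderiv_zeta hx]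
    simp [sub_eq_add_neg]
  have h := ContDiffOn.fderiv_fderiv_symm hs.isOpen hs.contDiffOn_zeta hx u v
  rw [key, key, neg_inj, sub_eq_sub_iff_add_eq_add] at h
  rw [hs.curvature_eq hx, h, sub_self]

lemma eta_curvature (hs : IsCoordParaCosymplectic G P Z E U) (hx : x ∈ U) (u v w : Coord n) :
    E x (curvature G x u v w) = 0 := by
  rw [← hs.metric_zeta hx, hs.curvature_skew hx, hs.curvature_zeta hx, map_zero, neg_zero]

/-- By Bianchi and `curvature_zeta`, $g(R(\zeta,a)b,c)$ is symmetric in $a,b$; it is also skew in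
$b,c$. A trilinear form with both symmetries is zero. -/
lemma zeta_curvature (hs : IsCoordParaCosymplectic G P Z E U) (hx : x ∈ U) (v w : Coord n) :
    curvature G x (Z x) v w = 0 := by
  have symm : ∀ a b, curvature G x (Z x) a b = curvature G x (Z x) b a := by
    intro a b
    have h := hs.curvature_bianchi hx (Z x) a b
    rw [hs.curvature_zeta hx, add_zero, hs.curvature_antisymm hx b] at h
    exact add_neg_eq_zero.1 h
  refine hs.nondegenerate x hx _ fun z => ?_
  have hsk : ∀ a b c, G x (curvature G x (Z x) a b) c = -G x (curvature G x (Z x) a c) b :=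
    fun a b c => by rw [hs.curvature_skew hx, hs.symm x hx]
  have h1 := hsk v w z
  rw [symm v z] at h1
  have h2 := hsk z v w
  rw [symm z w] at h2
  have h3 := hsk w z v
  rw [symm w v] at h3
  linarith

end IsCoordParaCosymplectic

end ParaCosymplectic

/-! ### Dimension three: null frames, the Ricci tensor and the soliton equation -/

section DimensionThree

variable {G : Coord 3 → Coord 3 →L[ℝ] Coord 3 →L[ℝ] ℝ}
  {P : Coord 3 → Coord 3 →L[ℝ] Coord 3} {Z : Coord 3 → Coord 3} {E : Coord 3 → Coord 3 →L[ℝ] ℝ}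
  {U : Set (Coord 3)} {x p q : Coord 3}

/-- `p` and `q` span the two eigendistributions of `φ` at a point. -/
structure IsNullFrame (A : Coord 3 →L[ℝ] Coord 3) (p q : Coord 3) : Prop where
  apply_pos : A p = p
  apply_neg : A q = -q
  pos_ne_zero : p ≠ 0
  neg_ne_zero : q ≠ 0

namespace IsCoordParaCosymplectic

lemma eta_pos (hs : IsCoordParaCosymplectic G P Z E U) (hx : x ∈ U)
    (hpq : IsNullFrame (P x) p q) : E x p = 0 := by
  rw [← hpq.apply_pos, hs.eta_phi hx]

lemma eta_neg (hs : IsCoordParaCosymplectic G P Z E U) (hx : x ∈ U)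
    (hpq : IsNullFrame (P x) p q) : E x q = 0 := by
  rw [← neg_neg q, ← hpq.apply_neg, map_neg, hs.eta_phi hx, neg_zero]

lemma metric_pos_pos (hs : IsCoordParaCosymplectic G P Z E U) (hx : x ∈ U)
    (hpq : IsNullFrame (P x) p q) : G x p p = 0 := by
  have h := hs.metric_phi_skew hx p p
  rw [hpq.apply_pos] at h
  linarith

lemma metric_neg_neg (hs : IsCoordParaCosymplectic G P Z E U) (hx : x ∈ U)
    (hpq : IsNullFrame (P x) p q) : G x q q = 0 := by
  have h := hs.metric_phi_skew hx q q
  simp only [hpq.apply_neg, map_neg, neg_apply] at h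
  linarith

lemma linearIndependent_frame (hs : IsCoordParaCosymplectic G P Z E U) (hx : x ∈ U)
    (hpq : IsNullFrame (P x) p q) : LinearIndependent ℝ ![Z x, p, q] := by
  rw [Fintype.linearIndependent_iff]
  intro c hc
  simp only [Fin.sum_univ_three, Matrix.cons_val] at hc
  have h0 : c 0 = 0 := by
    simpa [hs.eta_zeta x hx, hs.eta_pos hx hpq, hs.eta_neg hx hpq] using congrArg (E x) hc
  rw [h0, zero_smul, zero_add] at hc
  have h1 : c 1 • p - c 2 • q = 0 := by
    simpa [hpq.apply_pos, hpq.apply_neg, sub_eq_add_neg] using congrArg (P x) hc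
  have h2 : (2 * c 1) • p = 0 := by
    calc (2 * c 1) • p = (c 1 • p + c 2 • q) + (c 1 • p - c 2 • q) := by module
      _ = 0 := by rw [hc, h1, add_zero]
  have h3 : (2 * c 2) • q = 0 := by
    calc (2 * c 2) • q = (c 1 • p + c 2 • q) - (c 1 • p - c 2 • q) := by module
      _ = 0 := by rw [hc, h1, sub_zero]
  have h4 := (smul_eq_zero.1 h2).resolve_right hpq.pos_ne_zero
  have h5 := (smul_eq_zero.1 h3).resolve_right hpq.neg_ne_zero
  intro i
  fin_cases i
  · exact h0
  · simpa using h4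
  · simpa using h5

/-- The frame `(ζ, p, q)` as a basis. -/
noncomputable def frameBasis (hs : IsCoordParaCosymplectic G P Z E U) (hx : x ∈ U)
    (hpq : IsNullFrame (P x) p q) : Module.Basis (Fin 3) ℝ (Coord 3) :=
  basisOfLinearIndependentOfCardEqFinrank (hs.linearIndependent_frame hx hpq) (by simp)

lemma coe_frameBasis (hs : IsCoordParaCosymplectic G P Z E U) (hx : x ∈ U)
    (hpq : IsNullFrame (P x) p q) : ⇑(hs.frameBasis hx hpq) = ![Z x, p, q] := by
  simp [frameBasis]

lemma sum_frameBasis (hs : IsCoordParaCosymplectic G P Z E U) (hx : x ∈ U)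
    (hpq : IsNullFrame (P x) p q) (w : Coord 3) :
    (hs.frameBasis hx hpq).repr w 0 • Z x + (hs.frameBasis hx hpq).repr w 1 • p
      + (hs.frameBasis hx hpq).repr w 2 • q = w := by
  have h := (hs.frameBasis hx hpq).sum_repr w
  simpa only [Fin.sum_univ_three, hs.coe_frameBasis, Matrix.cons_val] using h

/-- $p$ is already orthogonal to $\zeta$ and to itself, so nondegeneracy forces it to pair with $q$.
-/
lemma metric_pos_neg_ne_zero (hs : IsCoordParaCosymplectic G P Z E U) (hx : x ∈ U)
    (hpq : IsNullFrame (P x) p q) : G x p q ≠ 0 := by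
  intro h
  refine hpq.pos_ne_zero (hs.nondegenerate x hx p fun v => ?_)
  rw [← hs.sum_frameBasis hx hpq v]
  simp [hs.metric_zeta hx, hs.eta_pos hx hpq, hs.metric_pos_pos hx hpq, h]

lemma repr_zeta (hs : IsCoordParaCosymplectic G P Z E U) (hx : x ∈ U)
    (hpq : IsNullFrame (P x) p q) (w : Coord 3) :
    (hs.frameBasis hx hpq).repr w 0 = E x w := by
  conv_rhs => rw [← hs.sum_frameBasis hx hpq w]
  simp [hs.eta_zeta x hx, hs.eta_pos hx hpq, hs.eta_neg hx hpq]

lemma repr_pos (hs : IsCoordParaCosymplectic G P Z E U) (hx : x ∈ U)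
    (hpq : IsNullFrame (P x) p q) (w : Coord 3) :
    (hs.frameBasis hx hpq).repr w 1 = G x w q / G x p q := by
  rw [eq_div_iff (hs.metric_pos_neg_ne_zero hx hpq)]
  conv_rhs => rw [← hs.sum_frameBasis hx hpq w]
  simp [hs.zeta_metric hx, hs.eta_neg hx hpq, hs.metric_neg_neg hx hpq]

lemma repr_neg (hs : IsCoordParaCosymplectic G P Z E U) (hx : x ∈ U)
    (hpq : IsNullFrame (P x) p q) (w : Coord 3) :
    (hs.frameBasis hx hpq).repr w 2 = G x w p / G x p q := by
  rw [eq_div_iff (hs.metric_pos_neg_ne_zero hx hpq)]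
  conv_rhs => rw [← hs.sum_frameBasis hx hpq w]
  simp [hs.zeta_metric hx, hs.eta_pos hx hpq, hs.metric_pos_pos hx hpq, hs.symm x hx q p]

lemma eq_frame_sum (hs : IsCoordParaCosymplectic G P Z E U) (hx : x ∈ U)
    (hpq : IsNullFrame (P x) p q) (w : Coord 3) :
    w = ∑ i, ![E x w, G x w q / G x p q, G x w p / G x p q] i • ![Z x, p, q] i := by
  conv_lhs => rw [← hs.sum_frameBasis hx hpq w, hs.repr_zeta hx hpq, hs.repr_pos hx hpq,
    hs.repr_neg hx hpq]
  simp [Fin.sum_univ_three]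

/-- The Ricci tensor of a three-dimensional para-cosymplectic structure is a multiple of
`g - η ⊗ η`. -/
lemma exists_ricci_eq (hs : IsCoordParaCosymplectic G P Z E U) (hx : x ∈ U)
    (hpq : IsNullFrame (P x) p q) :
    ∃ ρ : ℝ, ∀ v w, ricci G x v w = ρ * (G x v w - E x v * E x w) := by
  have hk := hs.metric_pos_neg_ne_zero hx hpq
  have hzero : ∀ a b, curvature G x a a b = 0 := fun a b => by
    rw [hs.curvature_eq hx, sub_self]
  have hzr : ∀ a b, curvature G x a (Z x) b = 0 := fun a b => by
    rw [hs.curvature_antisymm hx, hs.zeta_curvature hx, neg_zero]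
  have hself : ∀ a b c, G x (curvature G x a b c) c = 0 := fun a b c => by
    have h := hs.curvature_skew hx a b c c
    rw [hs.symm x hx c] at h
    linarith
  set k := G x p q with hk_def
  set K := G x (curvature G x p q p) q with hK
  -- Only the $q$-component of $v$ and the $p$-component of $w$ contribute; the other terms vanish
  -- by skewness or because they contain $\zeta$.
  have hp1 : ∀ v w, G x (curvature G x p v w) q = G x v p / k * (G x w q / k * K) := by
    intro v w
    conv_lhs => rw [hs.eq_frame_sum hx hpq v, hs.curvature_sum_middle hx]
    simp only [Fin.sum_univ_three, Matrix.cons_val, hzr, hzero, smul_zero, zero_add, map_smul,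
      smul_apply, smul_eq_mul, add_zero, ← hk_def]
    conv_lhs => rw [hs.eq_frame_sum hx hpq w, hs.curvature_apply_sum hx]
    simp only [Fin.sum_univ_three, Matrix.cons_val, hs.curvature_zeta hx, smul_zero, zero_add,
      map_add, map_smul, add_apply, smul_apply, smul_eq_mul, hself, mul_zero, add_zero, ← hK,
      ← hk_def]
  have hp2 : ∀ v w, G x (curvature G x q v w) p = G x v q / k * (G x w p / k * K) := by
    intro v w
    have h1 : G x (curvature G x q p q) p = K := by
      rw [hs.curvature_antisymm hx, map_neg, neg_apply, hs.curvature_skew hx, neg_neg,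
        hs.symm x hx]
    conv_lhs => rw [hs.eq_frame_sum hx hpq v, hs.curvature_sum_middle hx]
    simp only [Fin.sum_univ_three, Matrix.cons_val, hzr, hzero, smul_zero, zero_add, map_smul,
      smul_apply, smul_eq_mul, add_zero, ← hk_def]
    conv_lhs => rw [hs.eq_frame_sum hx hpq w, hs.curvature_apply_sum hx]
    simp only [Fin.sum_univ_three, Matrix.cons_val, hs.curvature_zeta hx, smul_zero, zero_add,
      map_add, map_smul, add_apply, smul_apply, smul_eq_mul, hself, mul_zero, h1,
      ← hk_def]
  -- The trace is $\frac{K}{k^3}\big(g(v,p)g(w,q)+g(v,q)g(w,p)\big)$, and the bracket equals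
  -- $k(g-\eta\otimes\eta)(v,w)$.
  refine ⟨K / k ^ 2, fun v w => ?_⟩
  rw [hs.ricci_eq_sum_repr hx (hs.frameBasis hx hpq), Fin.sum_univ_three, hs.repr_zeta hx hpq,
    hs.repr_pos hx hpq, hs.repr_neg hx hpq, hs.eta_curvature hx]
  simp only [hs.coe_frameBasis, Matrix.cons_val, hp1, hp2, ← hk_def]
  have hv : G x v w = E x v * E x w + G x v q / k * G x w p + G x v p / k * G x w q := by
    conv_lhs => rw [hs.eq_frame_sum hx hpq v]
    simp only [Fin.sum_univ_three, Matrix.cons_val, map_add, map_smul, add_apply, smul_apply,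
      smul_eq_mul, hs.zeta_metric hx, ← hk_def]
    rw [hs.symm x hx p w, hs.symm x hx q w]
  rw [hv]
  field_simp
  ring

/-- In dimension three, `S = (r / 2) (g - η ⊗ η)`. -/
lemma ricci_eq (hs : IsCoordParaCosymplectic G P Z E U) (hx : x ∈ U)
    (hpq : IsNullFrame (P x) p q) (v w : Coord 3) :
    ricci G x v w = scalarCurvature G x / 2 * (G x v w - E x v * E x w) := by
  -- The metric trace of $g-\eta\otimes\eta$ is $3-1=2$, so $r=2\rho$.
  obtain ⟨ρ, hρ⟩ := hs.exists_ricci_eq hx hpq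
  rw [hs.scalarCurvature_eq hx (ρ := ρ) (z := Z x) (by simpa only [hs.zeta_metric hx] using hρ),
    hs.zeta_metric hx, hs.eta_zeta x hx, hρ]
  push_cast
  ring

/-- A function whose Hessian is `a g + b η ⊗ η` with `b` constant has constant `a`. -/
lemma fderiv_eq_zero_of_hessian_eq (hs : IsCoordParaCosymplectic G P Z E U)
    {F a : Coord 3 → ℝ} {b : ℝ} (hF : ContDiffOn ℝ ∞ F U) (ha : ContDiffOn ℝ ∞ a U)
    (hH : ∀ y ∈ U, ∀ u v, hessian G F y u v = a y * G y u v + b * (E y u * E y v))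
    (hx : x ∈ U) (hpq : IsNullFrame (P x) p q) : fderiv ℝ a x = 0 := by
  have hU := hs.isOpen
  have hF1 := ContDiffOn.fderiv_of_isOpen_infty hU hF
  have hax := ContDiffOn.differentiableAt_of_isOpen hU ha hx
  have hEx := hs.differentiableAt_eta hx
  have hGx := hs.differentiableAt hx
  have hEd : ∀ u, DifferentiableAt ℝ (fun y => E y u) x := fun u =>
    hEx.clm_apply (differentiableAt_const u)
  have hGd : ∀ u v, DifferentiableAt ℝ (fun y => G y u v) x := fun u v =>
    (hGx.clm_apply (differentiableAt_const u)).clm_apply (differentiableAt_const v)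
  have hW : ContDiffOn ℝ ∞ (fun y => fderiv ℝ F y (Z y)) U := hF1.clm_apply hs.contDiffOn_zeta
  -- Since $\zeta$ is parallel, $d(\zeta F)=\nabla^2F(\cdot,\zeta)$.
  have hW1 : ∀ u, ∀ y ∈ U, fderiv ℝ (fun y => fderiv ℝ F y (Z y)) y u = (a y + b) * E y u := by
    intro u y hy
    rw [fderiv_apply_field (ContDiffOn.differentiableAt_of_isOpen hU hF1 hy)
      (hs.differentiableAt_zeta hy), hs.fderiv_zeta hy, map_neg, ← sub_eq_add_neg,
      ← hs.hessian_eq hF hy, hH y hy, hs.metric_zeta hy, hs.eta_zeta y hy]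
    ring
  have hW2 : ∀ v u, fderiv ℝ (fderiv ℝ (fun y => fderiv ℝ F y (Z y))) x v u
      = fderiv ℝ a x v * E x u + (a x + b) * fderiv ℝ E x v u := by
    intro v u
    rw [← fderiv_apply_const (ContDiffOn.differentiableAt_of_isOpen hU
      (ContDiffOn.fderiv_of_isOpen_infty hU hW) hx), fderiv_congr_of_isOpen hU (hW1 u) hx,
      fderiv_fun_mul (hax.add_const b) (hEd u), fderiv_add_const, add_apply, smul_apply,
      smul_apply, fderiv_apply_const hEx]
    simp only [smul_eq_mul]
    ring
  -- $0=d\big((a+b)\eta\big)=da\wedge\eta$, evaluated on $(v,\zeta)$.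
  have hparallel : ∀ v, fderiv ℝ a x v = fderiv ℝ a x (Z x) * E x v := by
    intro v
    have h := ContDiffOn.fderiv_fderiv_symm hU hW hx v (Z x)
    rw [hW2, hW2, hs.fderiv_eta_symm hx v, hs.eta_zeta x hx] at h
    linarith
  have hdH : ∀ u v w, fderiv ℝ (fun y => hessian G F y v w) x u
      = fderiv ℝ a x u * G x v w + a x * fderiv ℝ G x u v w
        + b * (fderiv ℝ E x u v * E x w + E x v * fderiv ℝ E x u w) := by
    intro u v w
    rw [fderiv_congr_of_isOpen hU (fun y hy => hH y hy v w) hx,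
      fderiv_fun_add (hax.fun_mul (hGd v w)) (((hEd v).fun_mul (hEd w)).const_mul b),
      fderiv_fun_mul hax (hGd v w), fderiv_const_mul ((hEd v).fun_mul (hEd w)),
      fderiv_fun_mul (hEd v) (hEd w)]
    simp only [add_apply, smul_apply, fderiv_bilin_const hGx, fderiv_apply_const hEx, smul_eq_mul]
    ring
  -- In the Ricci identity on $(\zeta,p,q)$ the curvature term vanishes; $g$ and $\eta$ are parallel
  -- and $g(\zeta,q)=0$, so only $da(\zeta)\,g(p,q)$ survives.
  have hZ : fderiv ℝ a x (Z x) = 0 := by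
    have h := hs.fderiv_hessian_sub hF hx (Z x) p q
    rw [hs.zeta_curvature hx, map_zero, neg_zero, hdH, hdH, hH x hx, hH x hx,
      hs.fderiv_eq hx, hs.fderiv_eq hx, hs.fderiv_eta_eq hx, hs.fderiv_eta_eq hx,
      hs.fderiv_eta_eq hx, hs.fderiv_eta_eq hx, hs.christoffel_symm hx p (Z x),
      hs.zeta_metric hx q, hs.eta_neg hx hpq] at h
    have h2 : fderiv ℝ a x (Z x) * G x p q = 0 := by linarith
    exact (mul_eq_zero.1 h2).resolve_right (hs.metric_pos_neg_ne_zero hx hpq)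
  ext v
  rw [hparallel, hZ, zero_mul, zero_apply]

/-- The local form of the rigidity statement: `lam` has vanishing differential. -/
lemma fderiv_soliton_eq_zero (hs : IsCoordParaCosymplectic G P Z E U)
    (hframe : ∀ y ∈ U, ∃ p q, IsNullFrame (P y) p q) {F lam : Coord 3 → ℝ} {c r α β : ℝ}
    (hF : ContDiffOn ℝ ∞ F U) (hlam : ContDiffOn ℝ ∞ lam U)
    (hr : ∀ y ∈ U, scalarCurvature G y = r)
    (heq : ∀ y ∈ U, ∀ u v, c * hessian G F y u v
      + (lam y - β / 2 * scalarCurvature G y) * G y u v + α * ricci G y u v = 0)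
    (hx : x ∈ U) : fderiv ℝ lam x = 0 := by
  have hric : ∀ y ∈ U, ∀ u v, ricci G y u v = r / 2 * (G y u v - E y u * E y v) := by
    intro y hy u v
    obtain ⟨p, q, hpq⟩ := hframe y hy
    rw [hs.ricci_eq hy hpq, hr y hy]
  rcases eq_or_ne c 0 with rfl | hc
  -- At $(\zeta,\zeta)$ the Ricci term vanishes and $g(\zeta,\zeta)=1$.
  · have hl : ∀ y ∈ U, lam y = β / 2 * r := by
      intro y hy
      have h := heq y hy (Z y) (Z y)
      rw [hric y hy, hr y hy, hs.zeta_metric hy, hs.eta_zeta y hy] at h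
      linarith
    rw [fderiv_congr_of_isOpen hs.isOpen hl hx, fderiv_fun_const, Pi.zero_apply]
  · obtain ⟨p, q, hpq⟩ := hframe x hx
    -- The coefficient of $g$ after substituting $S=\frac r2(g-\eta\otimes\eta)$ and solving for the
    -- Hessian; that of $\eta\otimes\eta$ is constant because $r$ is.
    let a : Coord 3 → ℝ := fun y => -c⁻¹ * (lam y + (α * r / 2 - β / 2 * r))
    have ha : ContDiffOn ℝ ∞ a U := contDiffOn_const.mul (hlam.add contDiffOn_const)
    have h0 := hs.fderiv_eq_zero_of_hessian_eq (a := a) (b := c⁻¹ * (α * r / 2)) hF ha (by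
      intro y hy u v
      have h := heq y hy u v
      rw [hric y hy, hr y hy] at h
      have h' : hessian G F y u v = c⁻¹ * (c * hessian G F y u v) := by field_simp
      rw [h']
      simp only [a]
      linear_combination c⁻¹ * h) hx hpq
    have hl := ContDiffOn.differentiableAt_of_isOpen hs.isOpen hlam hx
    rw [show fderiv ℝ a x = (-c⁻¹) • fderiv ℝ lam x by
      simp only [a]
      rw [fderiv_const_mul (hl.add_const _), fderiv_add_const]] at h0
    exact (smul_eq_zero.1 h0).resolve_left (neg_ne_zero.2 (inv_ne_zero hc))

end IsCoordParaCosymplectic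

end DimensionThree

/-! ### Passage between the manifold and its charts -/

section Transfer

variable {n : ℕ} {M : Type*} [TopologicalSpace M] [ChartedSpace (Coord n) M]
  [IsManifold (𝓡 n) ∞ M] {e : OpenPartialHomeomorph M (Coord n)} {y : Coord n}

lemma chartDeriv_paramDeriv (he : e ∈ atlas (Coord n) M) (hy : y ∈ e.target) (u : Coord n) :
    chartDeriv e y (paramDeriv e y u) = u := by
  have : IsManifold (𝓡 n) 1 M := IsManifold.of_le (n := ∞) (by simp)
  exact congrArg (fun l => l u)
    ((mdifferentiable_of_mem_atlas (I := 𝓡 n) he).comp_symm_deriv hy)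

/-- A one-sided inverse of an endomorphism of a finite-dimensional space is two-sided; tangent
spaces are identified with `Coord n` for this. -/
lemma paramDeriv_chartDeriv (he : e ∈ atlas (Coord n) M) (hy : y ∈ e.target)
    (u : TangentSpace (𝓡 n) (e.symm y)) : paramDeriv e y (chartDeriv e y u) = u := by
  let A : Coord n →ₗ[ℝ] Coord n := (paramDeriv e y).toLinearMap
  let B : Coord n →ₗ[ℝ] Coord n := (chartDeriv e y).toLinearMap
  have h : B * A = 1 := LinearMap.ext fun v => chartDeriv_paramDeriv he hy v
  exact LinearMap.congr_fun (mul_eq_one_comm.1 h) u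

lemma contDiffOn_comp_symm {f : M → ℝ} (hf : ContMDiff (𝓡 n) 𝓘(ℝ, ℝ) ∞ f)
    (he : e ∈ atlas (Coord n) M) : ContDiffOn ℝ ∞ (f ∘ e.symm) e.target :=
  contMDiffOn_iff_contDiffOn.1 (hf.comp_contMDiffOn
    (contMDiffOn_symm_of_mem_maximalAtlas (IsManifold.subset_maximalAtlas he)))

lemma SemiRiemannianMetric.isCoordMetric (g : SemiRiemannianMetric n M)
    (he : e ∈ atlas (Coord n) M) : IsCoordMetric (coordBilin g.val e) e.target where
  isOpen := e.open_target
  contDiffOn := g.smooth e he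
  symm y _ u v := g.symm _ _ _
  nondegenerate y hy u hu := by
    have h : paramDeriv e y u = 0 := g.nondegenerate _ _ fun v => by
      have := hu (chartDeriv e y v)
      change g.val (e.symm y) (paramDeriv e y u) (paramDeriv e y (chartDeriv e y v)) = 0 at this
      rwa [paramDeriv_chartDeriv he hy] at this
    rw [← chartDeriv_paramDeriv he hy u, h, map_zero]

lemma AlmostParacontactMetricStructure.isCoordParaCosymplectic
    (s : AlmostParacontactMetricStructure n M) (hs : s.IsParaCosymplectic)
    (he : e ∈ atlas (Coord n) M) :
    IsCoordParaCosymplectic (coordBilin s.g.val e) (coordEndo s.phi e) (coordVec s.zeta e)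
      (coordForm s.eta e) e.target where
  toIsCoordMetric := s.g.isCoordMetric he
  contDiffOn_phi := s.smooth_phi e he
  contDiffOn_zeta := s.smooth_zeta e he
  contDiffOn_eta := s.smooth_eta e he
  phi_sq y hy u := by
    change chartDeriv e y (s.phi _ (paramDeriv e y (chartDeriv e y (s.phi _ (paramDeriv e y u)))))
      = u - s.eta _ (paramDeriv e y u) • chartDeriv e y (s.zeta _)
    rw [paramDeriv_chartDeriv he hy, s.phi_sq, map_sub, map_smul, chartDeriv_paramDeriv he hy]
  eta_zeta y hy := by
    change s.eta _ (paramDeriv e y (chartDeriv e y (s.zeta _))) = 1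
    rw [paramDeriv_chartDeriv he hy, s.eta_zeta]
  compatible y hy u v := by
    change s.g.val _ (paramDeriv e y (chartDeriv e y (s.phi _ (paramDeriv e y u))))
      (paramDeriv e y (chartDeriv e y (s.phi _ (paramDeriv e y v)))) = _
    rw [paramDeriv_chartDeriv he hy, paramDeriv_chartDeriv he hy, s.compatible]
    rfl
  dOneForm_eq_zero y hy u v := (hs.1 e he y hy).1 u v
  dTwoForm_eq_zero y hy u v w := (hs.1 e he y hy).2 u v w
  nijenhuis_eq_zero y hy u v := by
    have h := hs.2 e he y hy u v
    rwa [(hs.1 e he y hy).1 u v, zero_smul, sub_zero] at h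

/-- A function whose coordinate expressions have vanishing differential is constant. -/
lemma exists_eq_const_of_fderiv_eq_zero [PreconnectedSpace M] {f : M → ℝ}
    (hf : ContMDiff (𝓡 n) 𝓘(ℝ, ℝ) ∞ f)
    (h : ∀ e ∈ atlas (Coord n) M, ∀ y ∈ e.target, fderiv ℝ (f ∘ e.symm) y = 0) :
    ∃ c : ℝ, ∀ x, f x = c := by
  have hloc : IsLocallyConstant f := by
    rw [IsLocallyConstant.iff_eventually_eq]
    intro x
    have he := chart_mem_atlas (Coord n) x
    set e := chartAt (Coord n) x
    have hx : x ∈ e.source := mem_chart_source (Coord n) x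
    -- The chart's image need not be connected, so the argument runs on a ball inside it.
    obtain ⟨r, hr, hball⟩ := Metric.isOpen_iff.1 e.open_target (e x) (e.map_source hx)
    filter_upwards [e.open_source.mem_nhds hx,
      (e.continuousAt hx).preimage_mem_nhds (Metric.ball_mem_nhds _ hr)] with z hz hzr
    have hc := Metric.isOpen_ball.is_const_of_fderiv_eq_zero (𝕜 := ℝ) (f := f ∘ e.symm)
      (convex_ball (e x) r).isPreconnected
      (((contDiffOn_comp_symm hf he).differentiableOn (by simp)).mono hball)
      (fun y hy => h e he y (hball hy)) hzr (Metric.mem_ball_self hr)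
    simpa [e.left_inv hz, e.left_inv hx] using hc
  rcases isEmpty_or_nonempty M with hM | ⟨⟨x₀⟩⟩
  · exact ⟨0, fun x => hM.elim x⟩
  · exact ⟨f x₀, fun x => hloc.apply_eq_of_preconnectedSpace x x₀⟩

end Transfer

/-- With $2k+1=3$ both eigenspaces are nonzero; eigenvectors are carried to coordinates by the
chart's differential. -/
lemma AlmostParacontactMetricStructure.exists_isNullFrame {M : Type*} [TopologicalSpace M]
    [ChartedSpace (Coord 3) M] [IsManifold (𝓡 3) ∞ M]
    (s : AlmostParacontactMetricStructure 3 M) {e : OpenPartialHomeomorph M (Coord 3)}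
    (he : e ∈ atlas (Coord 3) M) {y : Coord 3} (hy : y ∈ e.target) :
    ∃ p q, IsNullFrame (coordEndo s.phi e y) p q := by
  have key : ∀ c : ℝ, 2 * Module.finrank ℝ (Module.End.eigenspace
      (s.phi (e.symm y) : TangentSpace (𝓡 3) (e.symm y) →ₗ[ℝ] TangentSpace (𝓡 3) (e.symm y)) c)
        + 1 = 3 → ∃ p, coordEndo s.phi e y p = c • p ∧ p ≠ 0 := by
    intro c hc
    have hne : Module.End.eigenspace (s.phi (e.symm y) :
        TangentSpace (𝓡 3) (e.symm y) →ₗ[ℝ] TangentSpace (𝓡 3) (e.symm y)) c ≠ ⊥ := by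
      intro h
      rw [h, finrank_bot] at hc
      omega
    obtain ⟨v, hv, hv0⟩ := Submodule.exists_mem_ne_zero_of_ne_bot hne
    have hv' : s.phi (e.symm y) v = c • v := Module.End.mem_eigenspace_iff.1 hv
    refine ⟨chartDeriv e y v, ?_, fun h => hv0 ?_⟩
    · change chartDeriv e y (s.phi _ (paramDeriv e y (chartDeriv e y v))) = _
      rw [paramDeriv_chartDeriv he hy, hv', map_smul]
    · rw [← paramDeriv_chartDeriv he hy v, h, map_zero]
  obtain ⟨p, hp, hp0⟩ := key 1 (s.finrank_eigenspace_one _)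
  obtain ⟨q, hq, hq0⟩ := key (-1) (s.finrank_eigenspace_neg_one _)
  exact ⟨p, q, by simpa using hp, by simpa using hq, hp0, hq0⟩

end ParaGeometry

theorem theorem7p2 {M : Type*} [TopologicalSpace M] [PreconnectedSpace M]
    [ChartedSpace (EuclideanSpace ℝ (Fin 3)) M] [IsManifold (𝓡 3) ∞ M]
    (s : ParaGeometry.AlmostParacontactMetricStructure 3 M)
    (hs : s.IsParaCosymplectic)
    (hr : s.g.HasConstantScalarCurvature)
    (h f lam : M → ℝ) (α β : ℝ)
    (h_const : ∃ c : ℝ, ∀ x : M, h x = c)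
    (hsol : ParaGeometry.IsHAlmostGradientRicciYamabeSoliton s.g h f lam α β) :
    ParaGeometry.IsHGradientRicciYamabeSoliton s.g h f lam α β := by
  obtain ⟨c, hc⟩ := h_const
  obtain ⟨r, hr⟩ := hr
  refine ⟨hsol, ParaGeometry.exists_eq_const_of_fderiv_eq_zero hsol.smooth_lam fun e he y hy => ?_⟩
  exact (s.isCoordParaCosymplectic hs he).fderiv_soliton_eq_zero
    (fun z hz => s.exists_isNullFrame he hz)
    (ParaGeometry.contDiffOn_comp_symm hsol.smooth_f he)
    (ParaGeometry.contDiffOn_comp_symm hsol.smooth_lam he) (hr e he)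
    (fun z hz u v => by simpa only [hc, Function.comp_apply] using hsol.equation e he z hz u v) hy
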